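/- **Theorem 3.2** ($\ell_1$-oracle inequality for the Lasso). Let $\mathbb H$ be a separable real Hilbert space, let $W=(W(h))_{h\in\mathbb H}$ be an isonormal Gaussian process, i.e. a centered Gaussian process with $\mathbb E[W(g)W(h)]=\langle g,h\rangle$ for all $g,h\in\mathbb H$, let $f\in\mathbb H$, $\varepsilon>0$, and let $Y(h)=\langle f,h\rangle+\varepsilon W(h)$ for $h\in\mathbb H$. Let $p\ge 1$ and let $\mathcal D_p=\{\varphi_1,\dots,\varphi_p\}\subset\mathbb H$ be a finite dictionary with $\max_{j}\|\varphi_j\|\le 1$. Assume that the version of $W$ has almost surely linear paths on the span of $\mathcal D_p$, i.e. almost surely $W(\sum_j\theta_j\varphi_j)=\sum_j\theta_jW(\varphi_j)$ for all $\theta\in\mathbb R^p$. Let $\mathcal L_1(\mathcal D_p)$ be the linear span of $\mathcal D_p$ with the norm $$\|h\|_{\mathcal L_1(\mathcal D_p)}=\inf\Big\{\sum_{j=1}^p|\theta_j| : \theta\in\mathbb R^p,\ h=\sum_{j=1}^p\theta_j\varphi_j\Big\},$$ let $\lambda_p\ge 4\varepsilon(\sqrt{\ln p}+1)$, and let the Lasso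 estimator be $$\hat f_p=\operatorname*{arg\,min}_{h\in\mathcal L_1(\mathcal D_p)}\big(-2Y(h)+\|h\|^2+\lambda_p\|h\|_{\mathcal L_1(\mathcal D_p)}\big),$$ a minimizer which almost surely exists and is unique. Then there is an absolute constant $C>0$ (not depending on $\mathbb H$, $W$, $f$, $\varepsilon$, $p$, $\mathcal D_p$, $\lambda_p$ or $z$) such that, for all $z>0$, with probability larger than $1-3.4\,e^{-z}$, $$\|f-\hat f_p\|^2+\lambda_p\|\hat f_p\|_{\mathcal L_1(\mathcal D_p)}\le C\Big[\inf_{h\in\mathcal L_1(\mathcal D_p)}\big(\|f-h\|^2+\lambda_p\|h\|_{\mathcal L_1(\mathcal D_p)}\big)+\lambda_p\,\varepsilon(1+z)\Big].$$ Moreover $\|f-\hat f_p\|^2+\lambda_p\|\hat f_p\|_{\mathcal L_1(\mathcal D_p)}$ is integrable and $$\mathbb E\Big[\|f-\hat f_p\|^2+\lambda_p\|\hat f_p\|_{\mathcal L_1(\mathcal D_p)}\Big]\le C\Big[\inf_{h\in\mathcal L_1(\mathcal D_p)}\big(\|f-h\|^2+\lambda_p\|h\|_{\mathcal L_1(\mathcal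 D_p)}\big)+\lambda_p\,\varepsilon\Big].$$ -/

import Mathlib

open MeasureTheory ProbabilityTheory

universe u v

noncomputable section

/-- An isonormal Gaussian process on the Hilbert space `H`: a centered Gaussian process
`(W h)` indexed by `h : H` with covariance `E[W(g) W(h)] = ⟪g, h⟫`. -/
structure IsIsonormal {H : Type u} [NormedAddCommGroup H] [InnerProductSpace ℝ H]
    {Ω : Type v} [MeasurableSpace Ω] (W : H → Ω → ℝ) (P : Measure Ω) : Prop where
  gaussian : IsGaussianProcess W P
  centered : ∀ h : H, ∫ ω, W h ω ∂P = 0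
  covariance : ∀ g h : H, ∫ ω, W g ω * W h ω ∂P = inner ℝ g h

/-- The observed process `Y(h) = ⟪f, h⟫ + ε W(h)`. -/
def observation {H : Type u} [NormedAddCommGroup H] [InnerProductSpace ℝ H]
    {Ω : Type v} (f : H) (ε : ℝ) (W : H → Ω → ℝ) (h : H) (ω : Ω) : ℝ :=
  inner ℝ f h + ε * W h ω

/-- The linear span of the dictionary `φ 0, …, φ (p - 1)`; for a finite dictionary this is the
whole space `L₁(D_p)`. -/
def dictSpan {H : Type u} [NormedAddCommGroup H] [InnerProductSpace ℝ H]
    {p : ℕ} (φ : Fin p → H) : Submodule ℝ H :=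
  Submodule.span ℝ (Set.range φ)

/-- The norm `‖h‖_{L₁(D_p)} = inf {∑ |θ_j| : h = ∑ θ_j φ_j}` (meaningful for `h` in the span). -/
def dictNorm {H : Type u} [NormedAddCommGroup H] [InnerProductSpace ℝ H]
    {p : ℕ} (φ : Fin p → H) (h : H) : ℝ :=
  sInf {r : ℝ | ∃ θ : Fin p → ℝ, h = ∑ j, θ j • φ j ∧ r = ∑ j, |θ j|}

/-- The empirical least squares criterion `γ(h) = -2 Y(h) + ‖h‖²` at a realization `y` of `Y`. -/
def lsCriterion {H : Type u} [NormedAddCommGroup H] [InnerProductSpace ℝ H]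
    (y : H → ℝ) (h : H) : ℝ :=
  -2 * y h + ‖h‖ ^ 2

/-- `g` is a Lasso solution at the realization `y` of `Y`: it minimizes
`γ(h) + lam ‖h‖_{L₁(D_p)}` over `h` in the span of the dictionary. -/
def IsLasso {H : Type u} [NormedAddCommGroup H] [InnerProductSpace ℝ H]
    {p : ℕ} (φ : Fin p → H) (lam : ℝ) (y : H → ℝ) (g : H) : Prop :=
  g ∈ dictSpan φ ∧
    IsMinOn (fun h => lsCriterion y h + lam * dictNorm φ h) (dictSpan φ : Set H) g

/-- The deterministic Lasso trade-off `inf_h (‖f - h‖² + lam ‖h‖_{L₁(D_p)})`, the infimum being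
over `h` in the span of the dictionary. -/
def oracleRisk {H : Type u} [NormedAddCommGroup H] [InnerProductSpace ℝ H]
    {p : ℕ} (φ : Fin p → H) (lam : ℝ) (f : H) : ℝ :=
  ⨅ h : dictSpan φ, (‖f - (h : H)‖ ^ 2 + lam * dictNorm φ (h : H))

end

/-!
The Lasso depends on the noise only through the functional `k ↦ W(k)` on the finite-dimensional
span `V` of the dictionary. There `W(k) = ⟪u, k⟫` for a standard Gaussian vector `u` of `V`
(`inner_pathVector`, `hasLaw_pathVector`), so everything reduces to geometry in `V` and to the
standard Gaussian measure.

*Splitting the noise.* Let `A` be the polar body of vectors `v` of `V` with `|⟪φ j, v⟫| ≤ M` for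
all `j`, where `M = (7/4) (√(log p) + 1)`. By a union bound `A` has Gaussian measure at least
`1/2` (`half_le_stdGaussian_polar`). Writing `u` as its nearest point in `A` plus a vector of
length `d = dist(u, A)` gives `W(k) ≤ M ‖k‖_{L₁} + d ‖k‖` for all `k` in the span
(`inner_le_dictNorm_add_infDist`). Comparing the values of the criterion at the Lasso `g` and at
any `h`, the first part of the noise is absorbed by the penalty, because `2 ε M ≤ (7/8) lam`, and
the second by half of the squared losses; what remains is of order `ε² d²`
(`lasso_le_oracleRisk`).

*Concentration.* The distance `d` is convex and 1-Lipschitz in `u` and vanishes on a set of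
measure at least `1/2`, so its exponential moments are at most `4 exp(2 l²)`
(`lintegral_exp_infDist_le`). This is the rotation argument of Maurey and Pisier: a
quarter turn from `u` to an independent copy is cut into small rotations, all of which preserve
the product measure, and convexity bounds each increment of `d` by the subgradient at the starting
point, so that no smoothness of `d` is needed (`lintegral_exp_sub_le_of_subgradient`). Markov's
inequality then gives the deviation bound, and `d² ≤ 2 exp d` the bound in expectation.

*Existence, uniqueness, measurability.* The criterion is a quadratic form plus a seminorm, so its
minimizer is unique and depends continuously on `u` (`exists_continuous_minimizer`). Hence any
almost sure choice of the Lasso is almost everywhere equal to a measurable one, which makes the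
risk almost everywhere strongly measurable without any assumption on the chosen version.
-/

open MeasureTheory ProbabilityTheory

/-! ### Distance to a closed convex set -/

section ConvexDistance

variable {V : Type*} [NormedAddCommGroup V] [InnerProductSpace ℝ V] [FiniteDimensional ℝ V]

/-- Nearest-point projection onto a closed convex set: a continuous map `q` into `A` with the
variational characterization of the nearest point. -/
lemma exists_continuous_nearest_point {A : Set V} (hA : IsClosed A) (hc : Convex ℝ A)
    (hne : A.Nonempty) :
    ∃ q : V → V, Continuous q ∧ (∀ u, q u ∈ A) ∧
      ∀ u, ∀ b ∈ A, inner ℝ (u - q u) (b - q u) ≤ 0 := by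
  have hex : ∀ u : V, ∃ v ∈ A, ∀ b ∈ A, inner ℝ (u - v) (b - v) ≤ 0 := by
    intro u
    obtain ⟨v, hv, h⟩ := exists_norm_eq_iInf_of_complete_convex hne hA.isComplete hc u
    exact ⟨v, hv, (norm_eq_iInf_iff_real_inner_le_zero hc hv).1 h⟩
  choose q hq hq' using hex
  refine ⟨q, ?_, hq, hq'⟩
  -- adding the two variational inequalities shows that `q` is nonexpansive
  have hlip : ∀ u v, ‖q u - q v‖ ≤ ‖u - v‖ := by
    intro u v
    have h1 := hq' u (q v) (hq v)
    have h2 := hq' v (q u) (hq u)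
    have h3 : ‖q u - q v‖ ^ 2 ≤ inner ℝ (u - v) (q u - q v) := by
      rw [← real_inner_self_eq_norm_sq]
      simp only [inner_sub_left, inner_sub_right] at *
      linarith [real_inner_comm (q u) (q v)]
    have h4 := real_inner_le_norm (u - v) (q u - q v)
    by_contra! h
    nlinarith [norm_nonneg (u - v)]
  exact (LipschitzWith.of_dist_le_mul (K := 1) (by simpa [dist_eq_norm] using hlip)).continuous

/-- The distance to a closed convex set has a measurable field of subgradients in the unit ball. -/
lemma exists_measurable_subgradient_infDist [MeasurableSpace V] [BorelSpace V]
    {A : Set V} (hA : IsClosed A) (hc : Convex ℝ A) (hne : A.Nonempty) :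
    ∃ s : V → V, Measurable s ∧ (∀ u, ‖s u‖ ≤ 1) ∧
      ∀ u v, Metric.infDist u A - Metric.infDist v A ≤ inner ℝ (s u) (u - v) := by
  obtain ⟨q, hqc, hqA, hq⟩ := exists_continuous_nearest_point hA hc hne
  refine ⟨fun u => ‖u - q u‖⁻¹ • (u - q u), ?_, ?_, ?_⟩
  · have : Measurable q := hqc.measurable
    fun_prop
  · intro u
    rw [norm_smul, norm_inv, norm_norm]
    exact inv_mul_le_one
  · intro u v
    have h1 : Metric.infDist u A ≤ ‖u - q u‖ := by
      simpa [dist_eq_norm] using Metric.infDist_le_dist_of_mem (x := u) (hqA u)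
    rcases (norm_nonneg (u - q u)).eq_or_lt with h0 | h0
    · simp only [← h0, inv_zero, zero_smul, inner_zero_left]
      linarith [Metric.infDist_nonneg (x := v) (s := A)]
    have h2 : ‖u - q u‖⁻¹ * inner ℝ (u - q u) (v - q u) ≤ Metric.infDist v A := by
      refine (Metric.le_infDist hne).2 fun b hb => ?_
      rw [dist_eq_norm, inv_mul_le_iff₀ h0]
      calc inner ℝ (u - q u) (v - q u)
          = inner ℝ (u - q u) (v - b) + inner ℝ (u - q u) (b - q u) := by
            rw [← inner_add_right]; congr 1; abel
        _ ≤ ‖u - q u‖ * ‖v - b‖ := by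
            linarith [hq u b hb, real_inner_le_norm (u - q u) (v - b)]
    have h3 : inner ℝ (‖u - q u‖⁻¹ • (u - q u)) (u - v)
        = ‖u - q u‖ - ‖u - q u‖⁻¹ * inner ℝ (u - q u) (v - q u) := by
      have : u - v = (u - q u) - (v - q u) := by abel
      rw [this, real_inner_smul_left, inner_sub_right, real_inner_self_eq_norm_sq]
      field_simp
    rw [h3]
    linarith

end ConvexDistance

section Polar

variable {V : Type*} [NormedAddCommGroup V] [InnerProductSpace ℝ V]

lemma isClosed_polar {ι : Type*} (g : ι → V) (M : ℝ) :
    IsClosed {u : V | ∀ j, |inner ℝ (g j) u| ≤ M} := by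
  simp only [Set.ofPred_forall]
  exact isClosed_iInter fun j => isClosed_le (by fun_prop) continuous_const

lemma convex_polar {ι : Type*} (g : ι → V) (M : ℝ) :
    Convex ℝ {u : V | ∀ j, |inner ℝ (g j) u| ≤ M} := by
  intro x hx y hy a b ha hb hab j
  rw [inner_add_right, real_inner_smul_right, real_inner_smul_right]
  refine (abs_add_le _ _).trans ?_
  rw [abs_mul, abs_mul, abs_of_nonneg ha, abs_of_nonneg hb]
  calc a * |inner ℝ (g j) x| + b * |inner ℝ (g j) y| ≤ a * M + b * M := by
        gcongr
        · exact hx j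
        · exact hy j
    _ = M := by rw [← add_mul, hab, one_mul]

end Polar

/-! ### Gaussian concentration -/

section Concentration

variable {V : Type*} [NormedAddCommGroup V] [InnerProductSpace ℝ V] [FiniteDimensional ℝ V]
  [MeasurableSpace V] [BorelSpace V]

lemma hasLaw_inner_stdGaussian (g : V) :
    HasLaw (fun u : V => inner ℝ g u) (gaussianReal 0 (‖g‖₊ ^ 2)) (stdGaussian V) := by
  have h := IsGaussian.map_eq_gaussianReal (μ := stdGaussian V) (innerSL ℝ g)
  rw [integral_strongDual_stdGaussian, variance_dual_stdGaussian, innerSL_apply_norm] at h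
  have hv : ‖g‖₊ ^ 2 = (‖g‖ ^ 2).toNNReal := by
    ext
    simp
  exact ⟨by fun_prop, by rw [hv]; exact h⟩

lemma lintegral_exp_inner_stdGaussian (g : V) :
    ∫⁻ u, ENNReal.ofReal (Real.exp (inner ℝ g u)) ∂(stdGaussian V)
      = ENNReal.ofReal (Real.exp (‖g‖ ^ 2 / 2)) := by
  have h := mgf_gaussianReal (hasLaw_inner_stdGaussian g).map_eq 1
  have hi : Integrable (fun u : V => Real.exp (1 * inner ℝ g u)) (stdGaussian V) := by
    have := integrable_exp_mul_gaussianReal (μ := 0) (v := ‖g‖₊ ^ 2) 1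
    rw [← (hasLaw_inner_stdGaussian g).map_eq] at this
    exact this.comp_aemeasurable (hasLaw_inner_stdGaussian g).aemeasurable
  simp only [mgf, one_mul] at h hi
  rw [← ofReal_integral_eq_lintegral_ofReal hi (ae_of_all _ fun _ => (Real.exp_pos _).le), h]
  simp

lemma stdGaussian_le_inner_le {g : V} (hg : ‖g‖ ≤ 1) {M : ℝ} (hM : 0 ≤ M) :
    stdGaussian V {u | M < inner ℝ g u} ≤ ENNReal.ofReal (Real.exp (-M ^ 2 / 2)) := by
  -- Chernoff's bound at the optimal parameter `M`
  calc stdGaussian V {u | M < inner ℝ g u}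
      = ∫⁻ _ in {u | M < inner ℝ g u}, 1 ∂(stdGaussian V) := by rw [setLIntegral_one]
    _ ≤ ∫⁻ u in {u | M < inner ℝ g u}, ENNReal.ofReal (Real.exp (-M ^ 2))
          * ENNReal.ofReal (Real.exp (inner ℝ (M • g) u)) ∂(stdGaussian V) := by
        refine setLIntegral_mono (by fun_prop) fun u hu => ?_
        rw [← ENNReal.ofReal_mul (Real.exp_pos _).le, ← Real.exp_add, ENNReal.one_le_ofReal,
          real_inner_smul_left]
        have : M < inner ℝ g u := hu
        exact Real.one_le_exp (by nlinarith)
    _ ≤ ∫⁻ u, ENNReal.ofReal (Real.exp (-M ^ 2))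
          * ENNReal.ofReal (Real.exp (inner ℝ (M • g) u)) ∂(stdGaussian V) :=
        setLIntegral_le_lintegral _ _
    _ ≤ ENNReal.ofReal (Real.exp (-M ^ 2 / 2)) := by
        rw [lintegral_const_mul _ (by fun_prop), lintegral_exp_inner_stdGaussian,
          ← ENNReal.ofReal_mul (Real.exp_pos _).le, ← Real.exp_add, norm_smul, Real.norm_eq_abs,
          mul_pow, sq_abs]
        have : ‖g‖ ^ 2 ≤ 1 := pow_le_one₀ (norm_nonneg _) hg
        refine ENNReal.ofReal_le_ofReal (Real.exp_le_exp.2 ?_)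
        nlinarith [sq_nonneg M]

/-- A polar body `{u : |⟪g j, u⟫| ≤ M for all j}` of finitely many vectors of the unit ball has
Gaussian measure at least one half as soon as `M` is of order `√(log p)`. -/
lemma half_le_stdGaussian_polar {p : ℕ} {g : Fin p → V} (hg : ∀ j, ‖g j‖ ≤ 1) {M : ℝ}
    (hM : 0 ≤ M) (hp : 4 * p * Real.exp (-M ^ 2 / 2) ≤ 1) :
    1 / 2 ≤ stdGaussian V {u | ∀ j, |inner ℝ (g j) u| ≤ M} := by
  have hmeas := (isClosed_polar g M).measurableSet
  have hcompl : stdGaussian V {u | ∀ j, |inner ℝ (g j) u| ≤ M}ᶜ ≤ 1 / 2 := by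
    have hsub : {u : V | ∀ j, |inner ℝ (g j) u| ≤ M}ᶜ
        ⊆ ⋃ j, ({u | M < inner ℝ (g j) u} ∪ {u | M < inner ℝ (-g j) u}) := by
      intro u hu
      simp only [Set.mem_compl_iff, Set.mem_ofPred_eq, not_forall, not_le] at hu
      obtain ⟨j, hj⟩ := hu
      refine Set.mem_iUnion.2 ⟨j, ?_⟩
      simpa [inner_neg_left] using lt_abs.1 hj
    calc stdGaussian V {u | ∀ j, |inner ℝ (g j) u| ≤ M}ᶜ
        ≤ ∑ j : Fin p, (ENNReal.ofReal (Real.exp (-M ^ 2 / 2))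
            + ENNReal.ofReal (Real.exp (-M ^ 2 / 2))) := by
          refine (measure_mono hsub).trans ((measure_iUnion_fintype_le _ _).trans ?_)
          refine Finset.sum_le_sum fun j _ => (measure_union_le _ _).trans (add_le_add ?_ ?_)
          · exact stdGaussian_le_inner_le (hg j) hM
          · exact stdGaussian_le_inner_le (by simpa using hg j) hM
      _ = ENNReal.ofReal (p * (2 * Real.exp (-M ^ 2 / 2))) := by
          rw [Finset.sum_const, Finset.card_univ, Fintype.card_fin, nsmul_eq_mul,
            ← ENNReal.ofReal_add (Real.exp_pos _).le (Real.exp_pos _).le,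
            ENNReal.ofReal_mul (Nat.cast_nonneg p), ENNReal.ofReal_natCast, two_mul]
      _ ≤ ENNReal.ofReal (1 / 2) := ENNReal.ofReal_le_ofReal (by linarith)
      _ = 1 / 2 := by rw [ENNReal.ofReal_div_of_pos (by norm_num)]; simp
  rw [prob_compl_eq_one_sub hmeas] at hcompl
  have h1 : (1 : ENNReal) ≤ 1 / 2 + stdGaussian V {u | ∀ j, |inner ℝ (g j) u| ≤ M} :=
    tsub_le_iff_right.1 hcompl
  by_contra! hlt
  have h2 := ENNReal.add_lt_add_left (a := 1 / 2) (by norm_num) hlt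
  rw [ENNReal.add_halves] at h2
  exact absurd h1 (not_le.2 h2)

/-- Exponential moments of small multiples of the norm are close to one. -/
lemma exists_lintegral_exp_norm_div_le (c : ℝ) (hc : 0 ≤ c) :
    ∃ n : ℕ, 0 < n ∧
      ∫⁻ u, ENNReal.ofReal (Real.exp (c / n * ‖u‖)) ∂(stdGaussian V) ≤ 2 := by
  have hint : Integrable (fun u : V => Real.exp (c * ‖u‖)) (stdGaussian V) := by
    obtain ⟨b, hb, h⟩ := IsGaussian.exists_integrable_exp_sq (stdGaussian V)
    refine (h.const_mul (Real.exp (c ^ 2 / (4 * b)))).mono' (by fun_prop) (ae_of_all _ fun u => ?_)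
    rw [Real.norm_eq_abs, abs_of_pos (Real.exp_pos _), ← Real.exp_add]
    refine Real.exp_le_exp.2 ?_
    have : 0 ≤ (c - 2 * b * ‖u‖) ^ 2 / (4 * b) := by positivity
    have h2 : (c - 2 * b * ‖u‖) ^ 2 / (4 * b) = c ^ 2 / (4 * b) + b * ‖u‖ ^ 2 - c * ‖u‖ := by
      field_simp; ring
    linarith
  have hfin : ∫⁻ u, ENNReal.ofReal (Real.exp (c * ‖u‖)) ∂(stdGaussian V) ≠ ⊤ := by
    rw [← ofReal_integral_eq_lintegral_ofReal hint (ae_of_all _ fun _ => (Real.exp_pos _).le)]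
    simp
  have hlim : Filter.Tendsto
      (fun n : ℕ => ∫⁻ u, ENNReal.ofReal (Real.exp (c / n * ‖u‖)) ∂(stdGaussian V))
      Filter.atTop (nhds (∫⁻ _, 1 ∂(stdGaussian V))) := by
    refine tendsto_lintegral_of_dominated_convergence
      (fun u => ENNReal.ofReal (Real.exp (c * ‖u‖))) (fun n => by fun_prop)
      (fun n => ae_of_all _ fun u => ?_) hfin (ae_of_all _ fun u => ?_)
    · refine ENNReal.ofReal_le_ofReal (Real.exp_le_exp.2 ?_)
      refine mul_le_mul_of_nonneg_right ?_ (norm_nonneg u)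
      rcases n.eq_zero_or_pos with rfl | hn
      · simpa using hc
      · exact div_le_self hc (by exact_mod_cast hn)
    · have h1 := (tendsto_const_div_atTop_nhds_zero_nat c).mul_const ‖u‖
      have h2 := ENNReal.tendsto_ofReal ((Real.continuous_exp.tendsto _).comp h1)
      simpa using h2
  rw [lintegral_one, measure_univ] at hlim
  have h2 : ∀ᶠ n : ℕ in Filter.atTop,
      ∫⁻ u, ENNReal.ofReal (Real.exp (c / n * ‖u‖)) ∂(stdGaussian V) < 2 :=
    hlim.eventually (gt_mem_nhds (by norm_num))
  obtain ⟨n, hn, hn'⟩ := (h2.and (Filter.eventually_gt_atTop 0)).exists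
  exact ⟨n, hn', hn.le⟩

/-- The product of two standard Gaussian measures is invariant under rotations. -/
lemma lintegral_rotation_stdGaussian (θ : ℝ) {G : V × V → ENNReal} (hG : Measurable G) :
    ∫⁻ p, G (ContinuousLinearMap.rotation θ p) ∂((stdGaussian V).prod (stdGaussian V))
      = ∫⁻ p, G p ∂((stdGaussian V).prod (stdGaussian V)) := by
  conv_rhs => rw [← IsGaussian.map_rotation_eq_self (μ := stdGaussian V) (by simp) θ]
  rw [lintegral_map hG (by fun_prop)]

/-- **Gaussian concentration of a difference.** If `F` has a measurable field of subgradients in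
the unit ball, then `F x - F y` is subgaussian for independent standard Gaussian vectors `x`, `y`.

The quarter turn from `x` to `y` is cut into `n` small rotations. The rotated pairs all have the
law of `(x, y)`, and each increment of `F` along the path is bounded by the linear functional
given by the subgradient, whose exponential moment is explicit. -/
lemma lintegral_exp_sub_le_of_subgradient {F : V → ℝ} {s : V → V}
    (hs : Measurable s) (hs1 : ∀ u, ‖s u‖ ≤ 1)
    (hsub : ∀ u v, F u - F v ≤ inner ℝ (s u) (u - v)) {l : ℝ} (hl : 0 ≤ l) :
    ∫⁻ p, ENNReal.ofReal (Real.exp (l * (F p.1 - F p.2)))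
        ∂((stdGaussian V).prod (stdGaussian V))
      ≤ 2 * ENNReal.ofReal (Real.exp (2 * l ^ 2)) := by
  obtain ⟨n, hn, hn2⟩ := exists_lintegral_exp_norm_div_le (V := V) (2 * l) (by positivity)
  have hn0 : (0 : ℝ) < n := by exact_mod_cast hn
  set δ : ℝ := Real.pi / (2 * n) with hδ
  have hnδ : n * δ = Real.pi / 2 := by rw [hδ]; field_simp
  have hδ0 : 0 ≤ δ := by positivity
  let R : ℕ → V × V → V × V := fun k => ContinuousLinearMap.rotation (k * δ)
  let h : V × V → ℝ := fun p =>
    (1 - Real.cos δ) * ‖p.1‖ - Real.sin δ * inner ℝ (s p.1) p.2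
  have hhm : Measurable h := by fun_prop
  -- one rotation step
  have hstep : ∀ (k : ℕ) (p : V × V), F (R k p).1 - F (R (k + 1) p).1 ≤ h (R k p) := by
    intro k p
    have hR : (R (k + 1) p).1 = Real.cos δ • (R k p).1 + Real.sin δ • (R k p).2 := by
      simp only [R, ContinuousLinearMap.rotation_apply, Nat.cast_add, Nat.cast_one, add_mul,
        one_mul, Real.cos_add, Real.sin_add]
      module
    refine (hsub _ _).trans ?_
    rw [hR]
    generalize R k p = w
    have : w.1 - (Real.cos δ • w.1 + Real.sin δ • w.2)
        = (1 - Real.cos δ) • w.1 - Real.sin δ • w.2 := by module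
    rw [this, inner_sub_right, real_inner_smul_right, real_inner_smul_right]
    have hle : inner ℝ (s w.1) w.1 ≤ ‖w.1‖ :=
      (real_inner_le_norm _ _).trans
        (by simpa using mul_le_mul_of_nonneg_right (hs1 w.1) (norm_nonneg w.1))
    have := mul_le_mul_of_nonneg_left hle (sub_nonneg.2 (Real.cos_le_one δ))
    simp only [h]
    linarith
  have hsum : ∀ p : V × V, F p.1 - F p.2 ≤ ∑ k ∈ Finset.range n, h (R k p) := by
    intro p
    have h0 : (R 0 p).1 = p.1 := by simp [R, ContinuousLinearMap.rotation_apply]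
    have h1 : (R n p).1 = p.2 := by simp [R, ContinuousLinearMap.rotation_apply, hnδ]
    rw [← h0, ← h1, ← Finset.sum_range_sub' (fun k => F (R k p).1)]
    exact Finset.sum_le_sum fun k _ => hstep k p
  -- Jensen's inequality for the average of the `n` increments
  have hjensen : ∀ p : V × V, Real.exp (l * (F p.1 - F p.2))
      ≤ ∑ k ∈ Finset.range n, (1 / n : ℝ) * Real.exp (n * l * h (R k p)) := by
    intro p
    have hj := convexOn_exp.map_sum_le (t := Finset.range n) (w := fun _ => (1 / n : ℝ))
      (p := fun k => n * l * h (R k p)) (fun _ _ => by positivity)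
      (by simp [hn0.ne']) (fun _ _ => Set.mem_univ _)
    simp only [smul_eq_mul] at hj
    refine le_trans (Real.exp_le_exp.2 ?_) hj
    calc l * (F p.1 - F p.2) ≤ l * ∑ k ∈ Finset.range n, h (R k p) :=
          mul_le_mul_of_nonneg_left (hsum p) hl
      _ = _ := by
          rw [Finset.mul_sum]
          refine Finset.sum_congr rfl fun k _ => ?_
          field_simp
  let G : V × V → ENNReal := fun p => ENNReal.ofReal (Real.exp (n * l * h p))
  have hG : Measurable G := by fun_prop
  have hcos : n * l * (1 - Real.cos δ) ≤ 2 * l / n := by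
    have h1 := Real.one_sub_sq_div_two_le_cos (x := δ)
    have h2 : n * l * (1 - Real.cos δ) ≤ n * l * (δ ^ 2 / 2) := by gcongr; linarith
    have h3 : n * l * (δ ^ 2 / 2) = l / n * (Real.pi ^ 2 / 8) := by rw [hδ]; field_simp; norm_num
    have h4 : Real.pi ^ 2 / 8 ≤ 2 := by nlinarith [Real.pi_lt_d2, Real.pi_pos]
    have h5 : l / n * (Real.pi ^ 2 / 8) ≤ l / n * 2 := by gcongr
    calc _ ≤ _ := h2
      _ ≤ _ := h3.trans_le h5
      _ = _ := by ring
  have hsin : (n * l * Real.sin δ) ^ 2 ≤ 4 * l ^ 2 := by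
    have h1 : |Real.sin δ| ≤ δ := (Real.abs_sin_le_abs).trans (abs_of_nonneg hδ0).le
    have h2 : (n * |Real.sin δ|) ^ 2 ≤ (Real.pi / 2) ^ 2 := by rw [← hnδ]; gcongr
    have h3 : (Real.pi / 2) ^ 2 ≤ 4 := by nlinarith [Real.pi_lt_d2, Real.pi_pos]
    rw [mul_pow, sq_abs] at h2
    nlinarith [mul_le_mul_of_nonneg_right (h2.trans h3) (sq_nonneg l)]
  have hGint : ∫⁻ p, G p ∂((stdGaussian V).prod (stdGaussian V))
      ≤ 2 * ENNReal.ofReal (Real.exp (2 * l ^ 2)) := by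
    rw [lintegral_prod _ hG.aemeasurable]
    calc ∫⁻ x, ∫⁻ y, G (x, y) ∂(stdGaussian V) ∂(stdGaussian V)
        ≤ ∫⁻ x, ENNReal.ofReal (Real.exp (2 * l / n * ‖x‖))
            * ENNReal.ofReal (Real.exp (2 * l ^ 2)) ∂(stdGaussian V) := by
          refine lintegral_mono fun x => ?_
          have hsplit : ∀ y, G (x, y) = ENNReal.ofReal (Real.exp (n * l * (1 - Real.cos δ) * ‖x‖))
              * ENNReal.ofReal (Real.exp (inner ℝ (-(n * l * Real.sin δ) • s x) y)) := by
            intro y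
            rw [← ENNReal.ofReal_mul (Real.exp_pos _).le, ← Real.exp_add, real_inner_smul_left]
            simp only [G, h]
            congr 2
            ring
          simp_rw [hsplit]
          rw [lintegral_const_mul _ (by fun_prop), lintegral_exp_inner_stdGaussian]
          refine mul_le_mul' (ENNReal.ofReal_le_ofReal (Real.exp_le_exp.2 ?_))
            (ENNReal.ofReal_le_ofReal (Real.exp_le_exp.2 ?_))
          · gcongr
          · rw [norm_smul, mul_pow, Real.norm_eq_abs, sq_abs, neg_sq]
            have : ‖s x‖ ^ 2 ≤ 1 := pow_le_one₀ (norm_nonneg _) (hs1 x)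
            nlinarith [sq_nonneg (n * l * Real.sin δ)]
      _ ≤ _ := by
          rw [lintegral_mul_const _ (by fun_prop)]
          gcongr
  calc ∫⁻ p, ENNReal.ofReal (Real.exp (l * (F p.1 - F p.2)))
        ∂((stdGaussian V).prod (stdGaussian V))
      ≤ ∫⁻ p, ∑ k ∈ Finset.range n, ENNReal.ofReal (1 / n) * G (R k p)
          ∂((stdGaussian V).prod (stdGaussian V)) := by
        refine lintegral_mono fun p => ?_
        refine (ENNReal.ofReal_le_ofReal (hjensen p)).trans_eq ?_
        rw [ENNReal.ofReal_sum_of_nonneg (fun _ _ => by positivity)]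
        exact Finset.sum_congr rfl fun k _ => ENNReal.ofReal_mul (by positivity)
    _ = ∑ k ∈ Finset.range n, ENNReal.ofReal (1 / n)
          * ∫⁻ p, G p ∂((stdGaussian V).prod (stdGaussian V)) := by
        rw [lintegral_finsetSum _ (fun k _ => by fun_prop)]
        refine Finset.sum_congr rfl fun k _ => ?_
        rw [lintegral_const_mul _ (by fun_prop), lintegral_rotation_stdGaussian _ hG]
    _ = ∫⁻ p, G p ∂((stdGaussian V).prod (stdGaussian V)) := by
        rw [Finset.sum_const, Finset.card_range, nsmul_eq_mul, ← mul_assoc,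
          ← ENNReal.ofReal_natCast, ← ENNReal.ofReal_mul hn0.le, mul_one_div_cancel hn0.ne',
          ENNReal.ofReal_one, one_mul]
    _ ≤ _ := hGint

/-- **Gaussian concentration around a convex set** of measure at least one half. -/
lemma lintegral_exp_infDist_le {A : Set V} (hA : IsClosed A) (hc : Convex ℝ A)
    (hhalf : 1 / 2 ≤ stdGaussian V A) {l : ℝ} (hl : 0 ≤ l) :
    ∫⁻ u, ENNReal.ofReal (Real.exp (l * Metric.infDist u A)) ∂(stdGaussian V)
      ≤ 4 * ENNReal.ofReal (Real.exp (2 * l ^ 2)) := by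
  have hne : A.Nonempty := by
    rw [Set.nonempty_iff_ne_empty]
    rintro rfl
    simp at hhalf
  obtain ⟨s, hs, hs1, hsub⟩ := exists_measurable_subgradient_infDist hA hc hne
  have hmeas : Measurable fun u : V => Metric.infDist u A := by fun_prop
  have h := lintegral_exp_sub_le_of_subgradient hs hs1 hsub hl
  rw [lintegral_prod _ (by fun_prop)] at h
  set I := ∫⁻ u, ENNReal.ofReal (Real.exp (l * Metric.infDist u A)) ∂(stdGaussian V)
  have h2 : I * (1 / 2) ≤ 2 * ENNReal.ofReal (Real.exp (2 * l ^ 2)) := by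
    refine le_trans ?_ h
    calc I * (1 / 2) ≤ I * stdGaussian V A := by gcongr
      _ = ∫⁻ x, ENNReal.ofReal (Real.exp (l * Metric.infDist x A)) * stdGaussian V A
            ∂(stdGaussian V) := by rw [lintegral_mul_const _ (by fun_prop)]
      _ ≤ _ := by
        refine lintegral_mono fun x => ?_
        rw [← setLIntegral_const]
        refine le_trans ?_ (setLIntegral_le_lintegral A _)
        refine setLIntegral_mono' hA.measurableSet fun y hy => ?_
        simp [Metric.infDist_zero_of_mem hy]
  calc I = 2 * (I * (1 / 2)) := by
        rw [mul_comm, mul_assoc, ENNReal.div_mul_cancel (by norm_num) (by norm_num), mul_one]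
    _ ≤ 2 * (2 * ENNReal.ofReal (Real.exp (2 * l ^ 2))) := by gcongr
    _ = _ := by rw [← mul_assoc]; norm_num

end Concentration

/-! ### The dictionary norm -/

section DictNorm

variable {H : Type u} [NormedAddCommGroup H] [InnerProductSpace ℝ H] {p : ℕ} {φ : Fin p → H}

instance finiteDimensional_dictSpan (φ : Fin p → H) : FiniteDimensional ℝ (dictSpan φ) :=
  FiniteDimensional.span_of_finite ℝ (Set.finite_range φ)

lemma mem_dictSpan_iff {h : H} : h ∈ dictSpan φ ↔ ∃ θ : Fin p → ℝ, h = ∑ j, θ j • φ j := by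
  simp only [dictSpan, Submodule.mem_span_range_iff_exists_fun, eq_comm]

lemma dictNorm_le_sum (θ : Fin p → ℝ) : dictNorm φ (∑ j, θ j • φ j) ≤ ∑ j, |θ j| := by
  refine csInf_le ⟨0, ?_⟩ ⟨θ, rfl, rfl⟩
  rintro r ⟨θ, -, rfl⟩
  positivity

lemma dictNorm_nonneg (h : H) : 0 ≤ dictNorm φ h := by
  refine Real.sInf_nonneg ?_
  rintro r ⟨θ, -, rfl⟩
  positivity

/-- On the span, the infimum defining `dictNorm` runs over a nonempty set, so that it is
approached by representations. -/
lemma exists_sum_abs_lt {h : H} (hh : h ∈ dictSpan φ) {η : ℝ} (hη : 0 < η) :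
    ∃ θ : Fin p → ℝ, h = ∑ j, θ j • φ j ∧ ∑ j, |θ j| < dictNorm φ h + η := by
  obtain ⟨θ₀, h₀⟩ := mem_dictSpan_iff.1 hh
  obtain ⟨r, ⟨θ, hθ, rfl⟩, hr⟩ := exists_lt_of_csInf_lt
    (s := {r : ℝ | ∃ θ : Fin p → ℝ, h = ∑ j, θ j • φ j ∧ r = ∑ j, |θ j|})
    ⟨_, θ₀, h₀, rfl⟩ (lt_add_of_pos_right (dictNorm φ h) hη)
  exact ⟨θ, hθ, hr⟩

/-- `dictNorm` as a seminorm on the span of the dictionary. -/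
noncomputable def dictSeminorm (φ : Fin p → H) : Seminorm ℝ (dictSpan φ) :=
  Seminorm.ofSMulLE (fun h => dictNorm φ (h : H))
    (by
      refine le_antisymm ?_ (dictNorm_nonneg _)
      simpa using dictNorm_le_sum (φ := φ) 0)
    (by
      intro x y
      refine le_of_forall_pos_le_add fun η hη => ?_
      obtain ⟨a, ha, ha'⟩ := exists_sum_abs_lt x.2 (half_pos hη)
      obtain ⟨b, hb, hb'⟩ := exists_sum_abs_lt y.2 (half_pos hη)
      have hab : ((x + y : dictSpan φ) : H) = ∑ j, (a + b) j • φ j := by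
        simp only [Submodule.coe_add, Pi.add_apply, add_smul, Finset.sum_add_distrib, ← ha, ← hb]
      have h1 : ∑ j, |(a + b) j| ≤ ∑ j, |a j| + ∑ j, |b j| := by
        rw [← Finset.sum_add_distrib]
        exact Finset.sum_le_sum fun j _ => abs_add_le _ _
      rw [hab]
      linarith [dictNorm_le_sum (φ := φ) (a + b)])
    (by
      intro c x
      have key : ∀ η : ℝ, 0 < η →
          dictNorm φ ((c • x : dictSpan φ) : H) ≤ ‖c‖ * (dictNorm φ (x : H) + η) := by
        intro η hη
        obtain ⟨a, ha, ha'⟩ := exists_sum_abs_lt x.2 hη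
        have hca : ((c • x : dictSpan φ) : H) = ∑ j, (c • a) j • φ j := by
          rw [Submodule.coe_smul, ha, Finset.smul_sum]
          simp [smul_smul]
        rw [hca]
        refine (dictNorm_le_sum (c • a)).trans ?_
        simp only [Pi.smul_apply, smul_eq_mul, abs_mul, ← Finset.mul_sum, Real.norm_eq_abs]
        gcongr
      refine ge_of_tendsto (x := nhdsWithin (0 : ℝ) (Set.Ioi 0))
        (f := fun η => ‖c‖ * (dictNorm φ (x : H) + η)) ?_
        (Filter.eventually_of_mem self_mem_nhdsWithin key)
      have : Continuous fun η : ℝ => ‖c‖ * (dictNorm φ (x : H) + η) := by fun_prop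
      simpa using (this.tendsto 0).mono_left nhdsWithin_le_nhds)

@[simp] lemma dictSeminorm_apply (h : dictSpan φ) : dictSeminorm φ h = dictNorm φ (h : H) := rfl

/-- Duality: a vector whose inner products with the dictionary are bounded by `M` is bounded by
`M` as a functional for the dictionary norm. -/
lemma inner_le_mul_dictNorm {u : H} {M : ℝ} (hM : 0 ≤ M) (hu : ∀ j, |inner ℝ (φ j) u| ≤ M)
    {g : H} (hg : g ∈ dictSpan φ) : inner ℝ u g ≤ M * dictNorm φ g := by
  have key : ∀ η : ℝ, 0 < η → inner ℝ u g ≤ M * (dictNorm φ g + η) := by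
    intro η hη
    obtain ⟨a, ha, ha'⟩ := exists_sum_abs_lt hg hη
    calc inner ℝ u g = ∑ j, a j * inner ℝ (φ j) u := by
          rw [ha, inner_sum]
          simp only [real_inner_smul_right, real_inner_comm u]
      _ ≤ ∑ j, |a j| * M := by
          refine Finset.sum_le_sum fun j _ => (le_abs_self _).trans ?_
          rw [abs_mul]
          exact mul_le_mul_of_nonneg_left (hu j) (abs_nonneg _)
      _ ≤ M * (dictNorm φ g + η) := by
          rw [← Finset.sum_mul, mul_comm]
          gcongr
  refine ge_of_tendsto (x := nhdsWithin (0 : ℝ) (Set.Ioi 0))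
    (f := fun η => M * (dictNorm φ g + η)) ?_
    (Filter.eventually_of_mem self_mem_nhdsWithin key)
  have : Continuous fun η : ℝ => M * (dictNorm φ g + η) := by fun_prop
  simpa using (this.tendsto 0).mono_left nhdsWithin_le_nhds

end DictNorm

/-! ### Penalized least squares with a seminorm penalty -/

section PenalizedLeastSquares

variable {V : Type*} [NormedAddCommGroup V] [InnerProductSpace ℝ V]

/-- The criterion `-2 ⟪z, k⟫ + ‖k‖² + lam N(k)`, which is `‖z - k‖² + lam N(k)` up to a
constant. -/
noncomputable def penalizedCriterion (N : Seminorm ℝ V) (lam : ℝ) (z k : V) : ℝ :=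
  -2 * inner ℝ z k + ‖k‖ ^ 2 + lam * N k

variable {N : Seminorm ℝ V} {lam : ℝ}

/-- Quadratic growth of the criterion around a minimizer, from a comparison with the midpoint. -/
lemma penalizedCriterion_add_le (hlam : 0 ≤ lam) {z g : V}
    (hg : ∀ k, penalizedCriterion N lam z g ≤ penalizedCriterion N lam z k) (k : V) :
    penalizedCriterion N lam z g + ‖g - k‖ ^ 2 / 2 ≤ penalizedCriterion N lam z k := by
  have h := hg ((1 / 2 : ℝ) • (g + k))
  have hN : N ((1 / 2 : ℝ) • (g + k)) ≤ (N g + N k) / 2 := by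
    rw [map_smul_eq_mul]
    norm_num
    linarith [map_add_le_add N g k]
  have hsq : ‖(1 / 2 : ℝ) • (g + k)‖ ^ 2 = (‖g‖ ^ 2 + ‖k‖ ^ 2) / 2 - ‖g - k‖ ^ 2 / 4 := by
    rw [norm_smul, mul_pow]
    norm_num
    linarith [parallelogram_law_with_norm ℝ g k]
  have hN' := mul_le_mul_of_nonneg_left hN hlam
  simp only [penalizedCriterion, hsq, real_inner_smul_right, inner_add_right] at *
  linarith

variable [FiniteDimensional ℝ V]

lemma Seminorm.continuous_of_finiteDimensional (N : Seminorm ℝ V) : Continuous N := by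
  rw [← continuousOn_univ]
  exact N.convexOn.continuousOn isOpen_univ

lemma exists_minimizer_penalizedCriterion (hlam : 0 ≤ lam) (z : V) :
    ∃ g, ∀ k, penalizedCriterion N lam z g ≤ penalizedCriterion N lam z k := by
  have hN := N.continuous_of_finiteDimensional
  have hcont : Continuous (penalizedCriterion N lam z) := by
    unfold penalizedCriterion
    fun_prop
  obtain ⟨g, -, hg⟩ := (isCompact_closedBall (0 : V) (2 * ‖z‖)).exists_isMinOn
    ⟨0, by simp⟩ hcont.continuousOn
  refine ⟨g, fun k => ?_⟩
  by_cases hk : k ∈ Metric.closedBall (0 : V) (2 * ‖z‖)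
  · exact hg hk
  -- outside the ball the criterion is nonnegative, and it vanishes at the origin
  have h0 : penalizedCriterion N lam z g ≤ penalizedCriterion N lam z 0 := hg (by simp)
  simp only [Metric.mem_closedBall, dist_zero_right, not_le] at hk
  have h1 := real_inner_le_norm z k
  have h2 : 0 ≤ lam * N k := mul_nonneg hlam (apply_nonneg N k)
  simp only [penalizedCriterion, inner_zero_right, norm_zero, map_zero] at *
  nlinarith [norm_nonneg k, norm_nonneg z]

/-- The penalized least squares criterion has exactly one minimizer, which depends continuously
on the data. -/
lemma exists_continuous_minimizer (N : Seminorm ℝ V) (hlam : 0 ≤ lam) :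
    ∃ m : V → V, Continuous m ∧ ∀ z g,
      (∀ k, penalizedCriterion N lam z g ≤ penalizedCriterion N lam z k) ↔ g = m z := by
  choose m hm using exists_minimizer_penalizedCriterion (N := N) hlam
  refine ⟨m, ?_, fun z g => ⟨fun hg => ?_, ?_⟩⟩
  · have hlip : ∀ y z, ‖m y - m z‖ ≤ 2 * ‖y - z‖ := by
      intro y z
      have h1 := penalizedCriterion_add_le hlam (hm y) (m z)
      have h2 := penalizedCriterion_add_le hlam (hm z) (m y)
      have h3 := real_inner_le_norm (y - z) (m y - m z)
      rw [norm_sub_rev] at h2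
      simp only [penalizedCriterion, inner_sub_left, inner_sub_right] at *
      by_contra! h
      nlinarith [norm_nonneg (y - z)]
    exact (LipschitzWith.of_dist_le_mul (K := 2) (by simpa [dist_eq_norm] using hlip)).continuous
  · have h1 := penalizedCriterion_add_le hlam hg (m z)
    have h2 := hm z g
    have h3 : ‖g - m z‖ ^ 2 ≤ 0 := by linarith
    exact sub_eq_zero.1 (norm_eq_zero.1 (pow_eq_zero_iff two_ne_zero |>.1
      (le_antisymm h3 (sq_nonneg _))))
  · rintro rfl
    exact hm z

end PenalizedLeastSquares

/-! ### The noise as a standard Gaussian vector of the span -/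

section PathVector

variable {H : Type u} [NormedAddCommGroup H] [InnerProductSpace ℝ H] {p : ℕ}

/-- The vector of the span of the dictionary with coordinates `w (b k)` in an orthonormal basis
`b` of the span. When `w` is linear on the span, this is its Riesz representative there. -/
noncomputable def pathVector (φ : Fin p → H) (w : H → ℝ) : dictSpan φ :=
  ∑ k, w (stdOrthonormalBasis ℝ (dictSpan φ) k) • stdOrthonormalBasis ℝ (dictSpan φ) k

lemma inner_pathVector {φ : Fin p → H} {w : H → ℝ}
    (hw : ∀ θ : Fin p → ℝ, w (∑ j, θ j • φ j) = ∑ j, θ j * w (φ j)) (g : dictSpan φ) :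
    inner ℝ (pathVector φ w) g = w g := by
  have hadd : ∀ x y : dictSpan φ, w ((x + y : dictSpan φ) : H) = w x + w y := by
    intro x y
    obtain ⟨a, ha⟩ := mem_dictSpan_iff.1 x.2
    obtain ⟨b, hb⟩ := mem_dictSpan_iff.1 y.2
    have : ((x + y : dictSpan φ) : H) = ∑ j, (a + b) j • φ j := by
      simp only [Submodule.coe_add, Pi.add_apply, add_smul, Finset.sum_add_distrib, ← ha, ← hb]
    rw [this, ha, hb, hw, hw, hw, ← Finset.sum_add_distrib]
    simp [add_mul]
  have hsmul : ∀ (c : ℝ) (x : dictSpan φ), w ((c • x : dictSpan φ) : H) = c * w x := by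
    intro c x
    obtain ⟨a, ha⟩ := mem_dictSpan_iff.1 x.2
    have : ((c • x : dictSpan φ) : H) = ∑ j, (c • a) j • φ j := by
      rw [Submodule.coe_smul, ha, Finset.smul_sum]
      simp [smul_smul]
    rw [this, ha, hw, hw, Finset.mul_sum]
    simp [mul_assoc]
  let ℓ : dictSpan φ →ₗ[ℝ] ℝ :=
    { toFun := fun x => w x, map_add' := hadd, map_smul' := hsmul }
  have hℓ : ∀ x : dictSpan φ, w x = ℓ x := fun _ => rfl
  conv_rhs => rw [hℓ, ← (stdOrthonormalBasis ℝ (dictSpan φ)).sum_repr g, map_sum]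
  rw [pathVector, sum_inner]
  refine Finset.sum_congr rfl fun k _ => ?_
  rw [real_inner_smul_left, map_smul, OrthonormalBasis.repr_apply_apply, ← hℓ, smul_eq_mul,
    mul_comm]

variable {Ω : Type v} [MeasurableSpace Ω] {P : Measure Ω} {W : H → Ω → ℝ}

lemma IsIsonormal.charFun_map [IsProbabilityMeasure P] (hW : IsIsonormal W P) (h : H) :
    charFun (P.map (W h)) 1 = Complex.exp (-‖h‖ ^ 2 / 2) := by
  have hvar : Var[W h; P] = ‖h‖ ^ 2 := by
    rw [variance_of_integral_eq_zero (hW.gaussian.aemeasurable h) (hW.centered h),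
      ← real_inner_self_eq_norm_sq, ← hW.covariance h h]
    simp [sq]
  rw [(hW.gaussian.hasGaussianLaw_eval h).map_eq_gaussianReal, hW.centered, hvar,
    charFun_gaussianReal]
  simp [neg_div]

/-- On the span of the dictionary, the noise is represented by a standard Gaussian vector. -/
lemma hasLaw_pathVector [IsProbabilityMeasure P] (hW : IsIsonormal W P) {φ : Fin p → H}
    [MeasurableSpace (dictSpan φ)] [BorelSpace (dictSpan φ)]
    (hlin : ∀ᵐ ω ∂P, ∀ θ : Fin p → ℝ, W (∑ j, θ j • φ j) ω = ∑ j, θ j * W (φ j) ω) :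
    HasLaw (fun ω => pathVector φ (fun h => W h ω)) (stdGaussian (dictSpan φ)) P := by
  have hmeas : AEMeasurable (fun ω => pathVector φ (fun h => W h ω)) P := by
    unfold pathVector
    refine Finset.aemeasurable_fun_sum _ fun k _ => ?_
    exact (hW.gaussian.aemeasurable _).smul_const _
  have : IsProbabilityMeasure (P.map fun ω => pathVector φ (fun h => W h ω)) :=
    Measure.isProbabilityMeasure_map hmeas
  refine ⟨hmeas, Measure.ext_of_charFun ?_⟩
  ext t
  rw [charFun_stdGaussian, charFun_apply, integral_map hmeas (by fun_prop)]
  have h := hW.charFun_map (t : H)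
  rw [charFun_apply_real, integral_map (hW.gaussian.aemeasurable _) (by fun_prop)] at h
  rw [← Submodule.coe_norm] at h
  rw [← h]
  refine integral_congr_ae ?_
  filter_upwards [hlin] with ω hω
  rw [inner_pathVector (w := fun h => W h ω) hω t]
  simp

end PathVector

/-! ### Oracle inequality on a realization -/

section Realization

variable {H : Type u} [NormedAddCommGroup H] [InnerProductSpace ℝ H] {p : ℕ} {φ : Fin p → H}
  {f : H} {ε lam : ℝ} {w : H → ℝ}

lemma isLasso_iff_penalizedCriterion {u : dictSpan φ} (hu : ∀ h : dictSpan φ, inner ℝ u h = w h)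
    (g : H) :
    IsLasso φ lam (fun h => inner ℝ f h + ε * w h) g ↔
      ∃ k : dictSpan φ, (k : H) = g ∧ ∀ h, penalizedCriterion (dictSeminorm φ) lam
        ((dictSpan φ).orthogonalProjectionOnto f + ε • u) k
          ≤ penalizedCriterion (dictSeminorm φ) lam
            ((dictSpan φ).orthogonalProjectionOnto f + ε • u) h := by
  have hcrit : ∀ h : dictSpan φ, penalizedCriterion (dictSeminorm φ) lam
      ((dictSpan φ).orthogonalProjectionOnto f + ε • u) h
        = lsCriterion (fun h => inner ℝ f h + ε * w h) (h : H) + lam * dictNorm φ (h : H) := by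
    intro h
    rw [penalizedCriterion, lsCriterion, inner_add_left, real_inner_smul_left, hu,
      Submodule.inner_orthogonalProjectionOnto_eq_of_mem_right, dictSeminorm_apply,
      Submodule.coe_norm]
  simp only [IsLasso, isMinOn_iff, hcrit]
  constructor
  · rintro ⟨hg, hmin⟩
    exact ⟨⟨g, hg⟩, rfl, fun h => hmin h h.2⟩
  · rintro ⟨k, rfl, hk⟩
    exact ⟨k.2, fun h hh => hk ⟨h, hh⟩⟩

/-- **Deterministic oracle inequality.** The noise enters only through the bound
`⟪u, k⟫ ≤ M ‖k‖_{L₁} + d ‖k‖`: the first part is absorbed by the penalty and the second one by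
the quadratic loss, at the price of the remainder `32 ε² d²`. -/
lemma lasso_le_oracleRisk {u : dictSpan φ} (hu : ∀ h : dictSpan φ, inner ℝ u h = w h)
    {M d : ℝ} (hd : 0 ≤ d) (hε : 0 < ε) (hlam : 0 ≤ lam) (hM : 2 * ε * M ≤ 7 / 8 * lam)
    (hdev : ∀ k : dictSpan φ, inner ℝ u k ≤ M * dictNorm φ (k : H) + d * ‖k‖) {g : H}
    (hg : IsLasso φ lam (fun h => inner ℝ f h + ε * w h) g) :
    ‖f - g‖ ^ 2 + lam * dictNorm φ g ≤ 15 * oracleRisk φ lam f + 32 * ε ^ 2 * d ^ 2 := by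
  suffices h : ∀ h : dictSpan φ, (‖f - g‖ ^ 2 + lam * dictNorm φ g - 32 * ε ^ 2 * d ^ 2) / 15
      ≤ ‖f - (h : H)‖ ^ 2 + lam * dictNorm φ (h : H) by
    have := le_ciInf h
    change _ ≤ oracleRisk φ lam f at this
    linarith
  intro h
  obtain ⟨hgV, hmin⟩ := hg
  have hbasic := isMinOn_iff.1 hmin h h.2
  have hexp : ∀ k : H, lsCriterion (fun h => inner ℝ f h + ε * w h) k
      = ‖f - k‖ ^ 2 - ‖f‖ ^ 2 - 2 * ε * w k := by
    intro k
    rw [lsCriterion, norm_sub_sq_real]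
    ring
  simp only [hexp] at hbasic
  have hw : w g - w h = inner ℝ u ((⟨g, hgV⟩ : dictSpan φ) - h) := by
    rw [inner_sub_right, hu, hu]
  have hnoise := hdev (⟨g, hgV⟩ - h)
  rw [← hw] at hnoise
  have hN : dictNorm φ (((⟨g, hgV⟩ : dictSpan φ) - h : dictSpan φ) : H)
      ≤ dictNorm φ g + dictNorm φ (h : H) :=
    map_sub_le_add (dictSeminorm φ) ⟨g, hgV⟩ h
  have hnorm : ‖(⟨g, hgV⟩ : dictSpan φ) - h‖ ≤ ‖f - g‖ + ‖f - (h : H)‖ := by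
    rw [Submodule.coe_norm, Submodule.coe_sub]
    calc ‖g - (h : H)‖ = ‖(f - (h : H)) - (f - g)‖ := by congr 1; abel
      _ ≤ ‖f - (h : H)‖ + ‖f - g‖ := norm_sub_le _ _
      _ = _ := add_comm _ _
  set n := dictNorm φ (((⟨g, hgV⟩ : dictSpan φ) - h : dictSpan φ) : H)
  have hn0 : 0 ≤ n := dictNorm_nonneg _
  have h1 : 2 * ε * M * n ≤ 7 / 8 * lam * (dictNorm φ g + dictNorm φ (h : H)) :=
    (mul_le_mul_of_nonneg_right hM hn0).trans
      (mul_le_mul_of_nonneg_left hN (by positivity))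
  have h2 : 2 * ε * (d * ‖(⟨g, hgV⟩ : dictSpan φ) - h‖)
      ≤ 2 * (ε * d) * (‖f - g‖ + ‖f - (h : H)‖) := by
    have : 0 ≤ 2 * (ε * d) := by positivity
    nlinarith [mul_le_mul_of_nonneg_left hnorm this]
  have h3 : 2 * ε * (w g - w h) ≤ 2 * ε * (M * n + d * ‖(⟨g, hgV⟩ : dictSpan φ) - h‖) :=
    mul_le_mul_of_nonneg_left hnoise (by positivity)
  have h4 := sq_nonneg (‖f - g‖ - 2 * (ε * d))
  have h5 := sq_nonneg (‖f - (h : H)‖ - 2 * (ε * d))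
  have h6 : 0 ≤ lam * dictNorm φ g := mul_nonneg hlam (dictNorm_nonneg _)
  have h7 : 0 ≤ lam * dictNorm φ (h : H) := mul_nonneg hlam (dictNorm_nonneg _)
  have h8 := sq_nonneg ‖f - g‖
  have h9 := sq_nonneg ‖f - (h : H)‖
  nlinarith

/-- Moving `u` to the nearest point of the polar body of the dictionary splits the functional
`⟪u, ·⟫` into a part controlled by the dictionary norm and one controlled by the norm. -/
lemma inner_le_dictNorm_add_infDist {M : ℝ} (hM : 0 ≤ M) {ψ : Fin p → dictSpan φ}
    (hψ : ∀ j, (ψ j : H) = φ j) (u k : dictSpan φ) :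
    inner ℝ u k ≤ M * dictNorm φ (k : H)
      + Metric.infDist u {v : dictSpan φ | ∀ j, |inner ℝ (ψ j) v| ≤ M} * ‖k‖ := by
  obtain ⟨a, ha, had⟩ := (isClosed_polar ψ M).exists_infDist_eq_dist
    ⟨0, fun j => by simpa using hM⟩ u
  have h1 : inner ℝ (a : H) (k : H) ≤ M * dictNorm φ (k : H) := by
    refine inner_le_mul_dictNorm hM (fun j => ?_) k.2
    rw [← hψ]
    exact ha j
  have h2 := real_inner_le_norm (u - a) k
  rw [had, dist_eq_norm]
  rw [inner_sub_left] at h2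
  rw [← Submodule.coe_inner] at h1
  linarith

end Realization

/-! ### The noise level and the conclusion -/

lemma four_mul_exp_noise_level_le {p : ℕ} (hp : 1 ≤ p) :
    4 * p * Real.exp (-(7 / 4 * (Real.sqrt (Real.log p) + 1)) ^ 2 / 2) ≤ 1 := by
  have hp0 : (0 : ℝ) < p := by exact_mod_cast hp
  have hlog : 0 ≤ Real.log p := Real.log_nonneg (by exact_mod_cast hp)
  have h4 : (4 * p : ℝ) = Real.exp (2 * Real.log 2 + Real.log p) := by
    rw [Real.exp_add, Real.exp_log hp0, two_mul, Real.exp_add, Real.exp_log (by norm_num)]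
    norm_num
  rw [h4, ← Real.exp_add]
  refine Real.exp_le_one_iff.2 ?_
  have h2 := Real.log_two_lt_d9
  nlinarith [Real.sq_sqrt hlog, Real.sqrt_nonneg (Real.log p)]

/-- There is a nonnegative random variable `d` with subgaussian exponential moments such that, on
almost every realization, the Lasso satisfies the oracle inequality with remainder `32 ε² d²`. -/
lemma exists_deviation {H : Type u} [NormedAddCommGroup H] [InnerProductSpace ℝ H]
    {Ω : Type v} [MeasurableSpace Ω] {P : Measure Ω} [IsProbabilityMeasure P]
    {W : H → Ω → ℝ} {f : H} {ε : ℝ} {p : ℕ} {φ : Fin p → H} {lam : ℝ}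
    (hW : IsIsonormal W P) (hε : 0 < ε) (hp : 1 ≤ p) (hφ : ∀ j, ‖φ j‖ ≤ 1)
    (hlin : ∀ᵐ ω ∂P, ∀ θ : Fin p → ℝ, W (∑ j, θ j • φ j) ω = ∑ j, θ j * W (φ j) ω)
    (hlam : 4 * ε * (Real.sqrt (Real.log p) + 1) ≤ lam) :
    ∃ d : Ω → ℝ, AEMeasurable d P ∧ (∀ ω, 0 ≤ d ω) ∧
      (∀ l : ℝ, 0 ≤ l → ∫⁻ ω, ENNReal.ofReal (Real.exp (l * d ω)) ∂P
        ≤ 4 * ENNReal.ofReal (Real.exp (2 * l ^ 2))) ∧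
      ∀ᵐ ω ∂P, ∀ g, IsLasso φ lam (fun h => observation f ε W h ω) g →
        ‖f - g‖ ^ 2 + lam * dictNorm φ g
          ≤ 15 * oracleRisk φ lam f + 32 * ε ^ 2 * d ω ^ 2 := by
  let _ : MeasurableSpace (dictSpan φ) := borel _
  have _ : BorelSpace (dictSpan φ) := ⟨rfl⟩
  have hlaw := hasLaw_pathVector hW hlin
  have hs := Real.sqrt_nonneg (Real.log p)
  set M : ℝ := 7 / 4 * (Real.sqrt (Real.log p) + 1) with hMdef
  have hM : 0 ≤ M := by positivity
  have hlam0 : 0 ≤ lam := le_trans (by positivity) hlam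
  let ψ : Fin p → dictSpan φ := fun j => ⟨φ j, Submodule.subset_span ⟨j, rfl⟩⟩
  let A : Set (dictSpan φ) := {v | ∀ j, |inner ℝ (ψ j) v| ≤ M}
  have hA : 1 / 2 ≤ stdGaussian (dictSpan φ) A :=
    half_le_stdGaussian_polar (g := ψ) hφ hM (four_mul_exp_noise_level_le hp)
  refine ⟨fun ω => Metric.infDist (pathVector φ fun h => W h ω) A, ?_, fun ω =>
    Metric.infDist_nonneg, fun l hl => ?_, ?_⟩
  · exact (Metric.continuous_infDist_pt A).measurable.comp_aemeasurable hlaw.aemeasurable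
  · rw [hlaw.lintegral_comp (f := fun u => ENNReal.ofReal (Real.exp (l * Metric.infDist u A)))
      (by fun_prop)]
    exact lintegral_exp_infDist_le (isClosed_polar ψ M) (convex_polar ψ M) hA hl
  · filter_upwards [hlin] with ω hω g hg
    refine lasso_le_oracleRisk (w := fun h => W h ω) (M := M) (inner_pathVector hω)
      Metric.infDist_nonneg hε hlam0 ?_ (fun k => inner_le_dictNorm_add_infDist hM
        (fun _ => rfl) _ k) hg
    rw [hMdef]
    linarith

/-- Almost surely the Lasso exists and is unique, and as a random vector of the span it is
almost everywhere strongly measurable. -/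
lemma ae_isLasso_iff {H : Type u} [NormedAddCommGroup H] [InnerProductSpace ℝ H]
    {Ω : Type v} [MeasurableSpace Ω] {P : Measure Ω} [IsProbabilityMeasure P]
    {W : H → Ω → ℝ} {p : ℕ} {φ : Fin p → H} (f : H) (ε : ℝ) {lam : ℝ}
    (hW : IsIsonormal W P)
    (hlin : ∀ᵐ ω ∂P, ∀ θ : Fin p → ℝ, W (∑ j, θ j • φ j) ω = ∑ j, θ j * W (φ j) ω)
    (hlam : 0 ≤ lam) :
    ∃ k : Ω → dictSpan φ, AEStronglyMeasurable k P ∧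
      ∀ᵐ ω ∂P, ∀ g, IsLasso φ lam (fun h => observation f ε W h ω) g ↔ g = k ω := by
  let _ : MeasurableSpace (dictSpan φ) := borel _
  have _ : BorelSpace (dictSpan φ) := ⟨rfl⟩
  have hlaw := hasLaw_pathVector hW hlin
  obtain ⟨m, hm, hmin⟩ := exists_continuous_minimizer (dictSeminorm φ) hlam
  refine ⟨fun ω => m ((dictSpan φ).orthogonalProjectionOnto f
    + ε • pathVector φ fun h => W h ω), ?_, ?_⟩
  · have hc : Continuous fun u : dictSpan φ =>
        m ((dictSpan φ).orthogonalProjectionOnto f + ε • u) := by fun_prop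
    exact hc.comp_aestronglyMeasurable hlaw.aemeasurable.aestronglyMeasurable
  · filter_upwards [hlin] with ω hω g
    refine (isLasso_iff_penalizedCriterion (w := fun h => W h ω)
      (inner_pathVector (w := fun h => W h ω) hω) g).trans ?_
    simp only [hmin]
    exact ⟨fun ⟨k, hk, h⟩ => by rw [← hk, h], fun h => ⟨_, h.symm, rfl⟩⟩

theorem theorem3p2 :
    ∃ C : ℝ, 0 < C ∧
      ∀ (H : Type u) [NormedAddCommGroup H] [InnerProductSpace ℝ H] [CompleteSpace H]
        [TopologicalSpace.SeparableSpace H]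
        (Ω : Type v) [MeasurableSpace Ω] (P : Measure Ω) [IsProbabilityMeasure P]
        (W : H → Ω → ℝ) (f : H) (ε : ℝ) (p : ℕ) (φ : Fin p → H) (lam : ℝ),
        IsIsonormal W P → 0 < ε → 1 ≤ p → (∀ j, ‖φ j‖ ≤ 1) →
        -- the paths of the chosen version of `W` are almost surely linear on the span
        (∀ᵐ ω ∂P, ∀ θ : Fin p → ℝ, W (∑ j, θ j • φ j) ω = ∑ j, θ j * W (φ j) ω) →
        4 * ε * (Real.sqrt (Real.log p) + 1) ≤ lam →
        -- the Lasso estimator is almost surely well defined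
        (∀ᵐ ω ∂P, ∃! g : H, IsLasso φ lam (fun h => observation f ε W h ω) g) ∧
        ∀ fhat : Ω → H,
          (∀ᵐ ω ∂P, IsLasso φ lam (fun h => observation f ε W h ω) (fhat ω)) →
          (∀ z : ℝ, 0 < z →
            1 - 3.4 * Real.exp (-z) <
              P.real {ω | ‖f - fhat ω‖ ^ 2 + lam * dictNorm φ (fhat ω) ≤
                C * (oracleRisk φ lam f + lam * ε * (1 + z))}) ∧
          Integrable (fun ω => ‖f - fhat ω‖ ^ 2 + lam * dictNorm φ (fhat ω)) P ∧
          ∫ ω, (‖f - fhat ω‖ ^ 2 + lam * dictNorm φ (fhat ω)) ∂P ≤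
            C * (oracleRisk φ lam f + lam * ε) := by
  refine ⟨500, by norm_num, ?_⟩
  intro H _ _ _ _ Ω _ P _ W f ε p φ lam hW hε hp hφ hlin hlam
  have hs := Real.sqrt_nonneg (Real.log p)
  have hlam0 : 0 ≤ lam := le_trans (by positivity) hlam
  have hεlam : ε ^ 2 ≤ lam * ε / 4 := by nlinarith [mul_nonneg hε.le hs]
  have hR : 0 ≤ oracleRisk φ lam f :=
    Real.iInf_nonneg fun h => add_nonneg (sq_nonneg _) (mul_nonneg hlam0 (dictNorm_nonneg _))
  obtain ⟨k, hkm, hk⟩ := ae_isLasso_iff f ε hW hlin hlam0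
  refine ⟨?_, fun fhat hfhat => ?_⟩
  · filter_upwards [hk] with ω hω
    exact ⟨k ω, (hω _).2 rfl, fun g hg => (hω g).1 hg⟩
  obtain ⟨d, hdm, hd0, hdexp, horacle⟩ := exists_deviation (f := f) hW hε hp hφ hlin hlam
  have hbound : ∀ᵐ ω ∂P, ‖f - fhat ω‖ ^ 2 + lam * dictNorm φ (fhat ω)
      ≤ 15 * oracleRisk φ lam f + 32 * ε ^ 2 * d ω ^ 2 := by
    filter_upwards [horacle, hfhat] with ω h1 h2 using h1 _ h2
  have hnonneg : ∀ ω, 0 ≤ ‖f - fhat ω‖ ^ 2 + lam * dictNorm φ (fhat ω) := fun ω =>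
    add_nonneg (sq_nonneg _) (mul_nonneg hlam0 (dictNorm_nonneg _))
  refine ⟨fun z hz => ?_, ?_⟩
  · -- the radius `t` balances the exponential moment at `t / 4` against `exp (-(1 + z))`
    set t : ℝ := Real.sqrt (8 * (1 + z)) with ht
    have ht2 : t ^ 2 = 8 * (1 + z) := Real.sq_sqrt (by positivity)
    have ht0 : 0 ≤ t := Real.sqrt_nonneg _
    set S := {ω | ‖f - fhat ω‖ ^ 2 + lam * dictNorm φ (fhat ω) ≤
      500 * (oracleRisk φ lam f + lam * ε * (1 + z))} with hS
    have hsub : ∀ᵐ ω ∂P, ω ∈ Sᶜ → ω ∈ {ω | t ≤ d ω} := by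
      filter_upwards [hbound] with ω hω hωS
      by_contra! hlt
      refine hωS ?_
      have hlt' : d ω < t := by simpa using hlt
      have hd2 : d ω ^ 2 ≤ 8 * (1 + z) := by
        rw [← ht2]
        exact pow_le_pow_left₀ (hd0 ω) hlt'.le 2
      have h1 := mul_le_mul_of_nonneg_left hd2 (sq_nonneg ε)
      have h2 := mul_le_mul_of_nonneg_right hεlam (by positivity : 0 ≤ 1 + z)
      change _ ≤ 500 * (oracleRisk φ lam f + lam * ε * (1 + z))
      have h3 : 0 ≤ lam * ε * (1 + z) := by positivity
      nlinarith
    have hmarkov : P {ω | t ≤ d ω} ≤ ENNReal.ofReal (4 * Real.exp (-(1 + z))) := by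
      have h1 := mul_meas_ge_le_lintegral₀
        (f := fun ω => ENNReal.ofReal (Real.exp (t / 4 * d ω))) (μ := P)
        (by fun_prop) (ENNReal.ofReal (Real.exp (t / 4 * t)))
      have h2 : P {ω | t ≤ d ω} ≤ P {ω | ENNReal.ofReal (Real.exp (t / 4 * t))
          ≤ ENNReal.ofReal (Real.exp (t / 4 * d ω))} := by
        refine measure_mono fun ω hω => ENNReal.ofReal_le_ofReal (Real.exp_le_exp.2 ?_)
        have : t ≤ d ω := hω
        gcongr
      have h3 := (h1.trans (hdexp (t / 4) (by positivity)))
      have h4 : ENNReal.ofReal (4 * Real.exp (-(1 + z))) = ENNReal.ofReal (Real.exp (-(t / 4 * t)))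
          * (4 * ENNReal.ofReal (Real.exp (2 * (t / 4) ^ 2))) := by
        rw [mul_left_comm, ← ENNReal.ofReal_mul (Real.exp_pos _).le, ← Real.exp_add,
          ENNReal.ofReal_mul (by norm_num)]
        have : -(t / 4 * t) + 2 * (t / 4) ^ 2 = -(1 + z) := by linear_combination -ht2 / 8
        rw [this]
        norm_num
      rw [h4]
      calc P {ω | t ≤ d ω} = ENNReal.ofReal (Real.exp (-(t / 4 * t)))
            * (ENNReal.ofReal (Real.exp (t / 4 * t)) * P {ω | t ≤ d ω}) := by
            rw [← mul_assoc, ← ENNReal.ofReal_mul (Real.exp_pos _).le, ← Real.exp_add]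
            simp
        _ ≤ _ := mul_le_mul_right ((mul_le_mul_right h2 _).trans h3) _
    have hcompl : P.real Sᶜ ≤ 4 * Real.exp (-(1 + z)) :=
      ENNReal.toReal_le_of_le_ofReal (by positivity) ((measure_mono_ae hsub).trans hmarkov)
    have hone : 1 ≤ P.real S + P.real Sᶜ := by
      have := measureReal_union_le (μ := P) S Sᶜ
      rwa [Set.union_compl_self, probReal_univ] at this
    have hnum : 4 * Real.exp (-(1 + z)) < 3.4 * Real.exp (-z) := by
      have he := Real.exp_one_gt_d9
      rw [neg_add, Real.exp_add, Real.exp_neg 1, ← mul_assoc]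
      refine mul_lt_mul_of_pos_right ?_ (Real.exp_pos _)
      rw [← div_eq_mul_inv, div_lt_iff₀ (Real.exp_pos 1)]
      linarith
    linarith
  · have hdfin : ∫⁻ ω, ENNReal.ofReal (Real.exp (d ω)) ∂P
        ≤ ENNReal.ofReal (4 * Real.exp 2) := by
      have h := hdexp 1 zero_le_one
      rw [ENNReal.ofReal_mul (by norm_num)]
      norm_num at h ⊢
      exact h
    have hdint : Integrable (fun ω => Real.exp (d ω)) P := by
      refine ⟨by fun_prop, ?_⟩
      rw [hasFiniteIntegral_iff_ofReal (ae_of_all _ fun _ => (Real.exp_pos _).le)]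
      exact hdfin.trans_lt ENNReal.ofReal_lt_top
    have hdmean : ∫ ω, Real.exp (d ω) ∂P ≤ 4 * Real.exp 2 := by
      rw [integral_eq_lintegral_of_nonneg_ae (ae_of_all _ fun _ => (Real.exp_pos _).le)
        (by fun_prop)]
      exact ENNReal.toReal_le_of_le_ofReal (by positivity) hdfin
    have hmajor : ∀ᵐ ω ∂P, ‖f - fhat ω‖ ^ 2 + lam * dictNorm φ (fhat ω)
        ≤ 15 * oracleRisk φ lam f + 64 * ε ^ 2 * Real.exp (d ω) := by
      filter_upwards [hbound] with ω hω
      have h1 := Real.quadratic_le_exp_of_nonneg (hd0 ω)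
      have h2 : d ω ^ 2 ≤ 2 * Real.exp (d ω) := by linarith [hd0 ω]
      nlinarith [mul_le_mul_of_nonneg_left h2 (sq_nonneg ε)]
    have hmajint : Integrable
        (fun ω => 15 * oracleRisk φ lam f + 64 * ε ^ 2 * Real.exp (d ω)) P :=
      (integrable_const _).add (hdint.const_mul _)
    have hmeas : AEStronglyMeasurable
        (fun ω => ‖f - fhat ω‖ ^ 2 + lam * dictNorm φ (fhat ω)) P := by
      have hc : Continuous fun h : dictSpan φ => ‖f - (h : H)‖ ^ 2 + lam * dictSeminorm φ h := by
        have := (dictSeminorm φ).continuous_of_finiteDimensional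
        fun_prop
      refine (hc.comp_aestronglyMeasurable hkm).congr ?_
      filter_upwards [hk, hfhat] with ω h1 h2
      rw [(h1 _).1 h2]
      rfl
    have hint : Integrable (fun ω => ‖f - fhat ω‖ ^ 2 + lam * dictNorm φ (fhat ω)) P := by
      refine hmajint.mono' hmeas ?_
      filter_upwards [hmajor] with ω hω
      rwa [Real.norm_eq_abs, abs_of_nonneg (hnonneg ω)]
    refine ⟨hint, (integral_mono_ae hint hmajint hmajor).trans ?_⟩
    rw [integral_add (integrable_const _) (hdint.const_mul _), integral_const_mul (64 * ε ^ 2)]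
    simp only [integral_const, probReal_univ, smul_eq_mul, one_mul]
    have he : Real.exp 2 < 7.39 := by
      have h1 := Real.exp_one_lt_d9
      have h2 : Real.exp 2 = Real.exp 1 ^ 2 := by rw [← Real.exp_nat_mul]; norm_num
      rw [h2]
      nlinarith [Real.exp_pos 1]
    have h1 : 64 * ε ^ 2 * ∫ ω, Real.exp (d ω) ∂P ≤ 64 * ε ^ 2 * 30 :=
      mul_le_mul_of_nonneg_left (by linarith) (by positivity)
    have h2 : 0 ≤ lam * ε := by positivity
    linarith
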